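/- All Hilbert spaces are complex, inner products $(\cdot,\cdot)$ are linear in the first entry, and $[\mathcal K,\mathcal H]$ denotes the bounded linear operators from $\mathcal K$ to $\mathcal H$. A linear relation from $X$ to $Y$ is a linear subspace of $X\times Y$; operators are identified with their graphs; $R^*$ is the adjoint relation, and $\operatorname{dom}R$, $\operatorname{ran}R$, $\ker R$ are the domain, range and kernel. A linear relation $S$ in a Hilbert space is symmetric if $S\subset S^*$, and has equal defect numbers if $\ker(S^*-\lambda)$ and $\ker(S^*-\mu)$ have the same Hilbert dimension whenever $\operatorname{Im}\lambda>0>\operatorname{Im}\mu$. Let $S$ be a closed symmetric linear relation in a Hilbert space $\mathfrak H$ and let $\mathcal H$ be a Hilbert space. A linear relation $\Gamma$ from $\mathfrak H^2$ to $\mathcal H^2$, whose elements are written $\{\hat f,\hat h\}$ with $\hat f=\{f,f'\}$, $\hat h=\{h,h'\}$, is a boundary relation for $S^*$ if $\operatorname{dom}\Gamma$ is a dense subspace of $S^*$, if Green's identity $$(f',g)-(f,g')=(h',k)-(h,k')\qquad(\mathrm{G})$$ holds for all $\{\hat f,\hat h\},\{\hat g,\hat k\}\in\Gamma$, and if every $\{\hat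 g,\hat k\}\in\mathfrak H^2\times\mathcal H^2$ satisfying (G) for all $\{\hat f,\hat h\}\in\Gamma$ belongs to $\Gamma$. Put $\Gamma_0=\{\{\hat f,h\}:\{\hat f,\{h,h'\}\}\in\Gamma\}$. The conditions (B1)–(B3) are: (B1) (G) holds on $\Gamma$; (B2) $\operatorname{ran}\Gamma_0=\mathcal H$; (B3) $\ker\Gamma_0$ is selfadjoint in $\mathfrak H$. For $\lambda\in\mathbb C\setminus\mathbb R$ the Weyl family and the $\gamma$-field of $\Gamma$ are the linear relations $$M(\lambda)=\{\hat h:\{\{f,\lambda f\},\hat h\}\in\Gamma\text{ for some }f\},\qquad \gamma(\lambda)=\{\{h,f\}:\{\{f,\lambda f\},\{h,h'\}\}\in\Gamma\text{ for some }h'\}.$$ **Proposition.** Let $\Gamma$ be a boundary relation for $S^*$ that satisfies (B1)–(B3), with $\mathcal H=\mathcal H_1\oplus\mathcal H_2$ an orthogonal sum of Hilbert spaces, and let $T\in[\mathcal H_2,\mathcal H_1]$. Write $h=(h_1,h_2)$ for $h\in\mathcal H$. Then: (i) $H_T=\{\hat f\in S^*:\{\hat f,\hat h\}\in\Gamma,\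 h=0,\ h_2'=-T^*h_1'\}$ is a closed symmetric linear relation in $\mathfrak H$ with equal defect numbers; (ii) $\Gamma_T=\{\{\hat f,\{h_2,\,T^*h_1'+h_2'\}\}:\{\hat f,\hat h\}\in\Gamma,\ h_1=Th_2\}$, a linear relation from $\mathfrak H^2$ to $\mathcal H_2^2$, is a boundary relation for $H_T^*$ that satisfies (B1)–(B3); (iii) $\operatorname{dom}\Gamma_T=\{\hat f\in S^*:\{\hat f,\hat h\}\in\Gamma,\ h_1=Th_2\}$; (iv)–(v) for every $\lambda\in\mathbb C\setminus\mathbb R$ the $\gamma$-field and the Weyl family of $\Gamma$ are (graphs of) bounded everywhere defined operators $\gamma(\lambda)=(\gamma_1(\lambda)\ \ \gamma_2(\lambda))\in[\mathcal H_1\oplus\mathcal H_2,\mathfrak H]$ and $M(\lambda)=(M_{ij}(\lambda))_{i,j=1}^2\in[\mathcal H_1\oplus\mathcal H_2]$, and the $\gamma$-field and the Weyl function of $\Gamma_T$ are $$\gamma_T(\lambda)=\gamma_1(\lambda)T+\gamma_2(\lambda),\qquad M_T(\lambda)=T^*M_{11}(\lambda)T+T^*M_{12}(\lambda)+M_{21}(\lambda)T+M_{22}(\lambda).$$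 **Corollary.** Let $S_j$ be a closed symmetric linear relation in a Hilbert space $\mathfrak H_j$ and let $\Gamma^{(j)}$ from $\mathfrak H_j^2$ to $\mathcal H^2$ be a boundary relation for $S_j^*$ that satisfies (B1)–(B3), $j=1,2$, with the same Hilbert space $\mathcal H$. Then, in $\mathfrak H=\mathfrak H_1\oplus\mathfrak H_2$: (i) $H^{(3)}=\{\hat f_1\oplus\hat f_2:\{\hat f_1,\{0,h_1\}\}\in\Gamma^{(1)},\ \{\hat f_2,\{0,-h_1\}\}\in\Gamma^{(2)}\text{ for some }h_1\in\mathcal H\}$ is a closed symmetric linear relation with equal defect numbers; (ii) $\Gamma^{(3)}=\{\{\hat f_1\oplus\hat f_2,\{h,h_1+h_2\}\}:\{\hat f_1,\{h,h_1\}\}\in\Gamma^{(1)},\ \{\hat f_2,\{h,h_2\}\}\in\Gamma^{(2)}\}$ is a boundary relation for $(H^{(3)})^*$ that satisfies (B1)–(B3); (iii) for every $\lambda\in\mathbb C\setminus\mathbb R$ the Weyl families of $\Gamma^{(1)},\Gamma^{(2)}$ are bounded everywhere defined operators $M_1(\lambda),M_2(\lambda)\in[\mathcal H]$, and the Weyl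 function of $\Gamma^{(3)}$ is $M_1(\lambda)+M_2(\lambda)$. -/

import Mathlib

noncomputable section

namespace BdryRel

universe u v w

/-! ### Linear relations

A linear relation from `X` to `Y` is a linear subspace of `X × Y`; its adjoint is
`Submodule.adjoint`. An element `{f, f'}` of `X × X` is a pair `(f, f')`. -/

section Relations

variable {X : Type u} {Y : Type v}
variable [AddCommGroup X] [Module ℂ X] [AddCommGroup Y] [Module ℂ Y]

/-- The domain of a linear relation. -/
def dom (R : Submodule ℂ (X × Y)) : Submodule ℂ X := R.map (LinearMap.fst ℂ X Y)

/-- The range of a linear relation. -/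
def ran (R : Submodule ℂ (X × Y)) : Submodule ℂ Y := R.map (LinearMap.snd ℂ X Y)

/-- The kernel `{x : {x, 0} ∈ R}` of a linear relation. -/
def ker (R : Submodule ℂ (X × Y)) : Submodule ℂ X := R.comap (LinearMap.inl ℂ X Y)

/-- The eigenspace `{f : {f, z f} ∈ R}` of a linear relation in `X`. -/
def eigenspace (R : Submodule ℂ (X × X)) (z : ℂ) : Submodule ℂ X :=
  R.comap (LinearMap.prod LinearMap.id (z • LinearMap.id))

end Relations

/-- The Hilbert dimension of a Hilbert space: the cardinality of an orthonormal (Hilbert) basis.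
All such bases have the same cardinality; the definition takes the least one. -/
def hilbertDim (E : Type u) [NormedAddCommGroup E] [InnerProductSpace ℂ E] : Cardinal.{u} :=
  sInf {c | ∃ ι : Type u, Nonempty (HilbertBasis ι ℂ E) ∧ Cardinal.mk ι = c}

/-- A linear relation in a Hilbert space `H`. -/
abbrev Rel (H : Type u) [NormedAddCommGroup H] [InnerProductSpace ℂ H] : Type u :=
  Submodule ℂ (H × H)

/-- A linear relation from `H²` to `K²`. -/
abbrev BRel (H : Type u) (K : Type v) [NormedAddCommGroup H] [InnerProductSpace ℂ H]
    [NormedAddCommGroup K] [InnerProductSpace ℂ K] : Type (max u v) :=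
  Submodule ℂ ((H × H) × (K × K))

section Symmetric

variable {H : Type u} [NormedAddCommGroup H] [InnerProductSpace ℂ H]

/-- A linear relation `S` in a Hilbert space is symmetric if `S ⊆ S*`. -/
def IsSymm (S : Rel H) : Prop := S ≤ S.adjoint

/-- A linear relation `A` in a Hilbert space is selfadjoint if `A = A*`. -/
def IsSelfAdj (A : Rel H) : Prop := A.adjoint = A

/-- `S` is closed (as a subspace of `H × H`) and symmetric. -/
def IsClosedSymm (S : Rel H) : Prop := IsClosed (S : Set (H × H)) ∧ IsSymm S

/-- The defect number of `S` at `z`: the Hilbert dimension of `ker (S* - z)`. -/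
def defect (S : Rel H) (z : ℂ) : Cardinal.{u} :=
  hilbertDim (eigenspace S.adjoint z)

/-- The defect numbers of `S` in the upper and in the lower half plane coincide. -/
def HasEqualDefect (S : Rel H) : Prop :=
  ∀ z w : ℂ, 0 < z.im → w.im < 0 → defect S z = defect S w

end Symmetric

/-! ### Boundary relations -/

section Boundary

variable {H : Type u} {K : Type v}
variable [NormedAddCommGroup H] [InnerProductSpace ℂ H]
variable [NormedAddCommGroup K] [InnerProductSpace ℂ K]

/-- The abstract Green's identity `(f', g) - (f, g') = (h', k) - (h, k')` for
`x = {{f, f'}, {h, h'}}` and `y = {{g, g'}, {k, k'}}`. The inner product `(a, b)` that is linear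
in `a` is `inner ℂ b a`. -/
def Green (x y : (H × H) × (K × K)) : Prop :=
  inner ℂ y.1.1 x.1.2 - inner ℂ y.1.2 x.1.1 = inner ℂ y.2.1 x.2.2 - inner ℂ y.2.2 x.2.1

/-- `Γ` is a boundary relation for `S*` (where `S` is a closed symmetric relation in `H`). -/
structure IsBoundaryRelation (S : Rel H)
    (Γ : BRel H K) : Prop where
  dom_le : dom Γ ≤ S.adjoint
  dom_dense : S.adjoint ≤ (dom Γ).topologicalClosure
  green : ∀ x ∈ Γ, ∀ y ∈ Γ, Green x y
  maximal : ∀ y : (H × H) × (K × K), (∀ x ∈ Γ, Green x y) → y ∈ Γ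

/-- `Γ₀ = {{f̂, h} : {f̂, {h, h'}} ∈ Γ}`. -/
def Gamma0 (Γ : BRel H K) : Submodule ℂ ((H × H) × K) :=
  Γ.map (LinearMap.prodMap LinearMap.id (LinearMap.fst ℂ K K))

/-- The three conditions: Green's identity holds, `ran Γ₀` is the whole space,
`ker Γ₀` is selfadjoint. -/
structure CondB (Γ : BRel H K) : Prop where
  b1 : ∀ x ∈ Γ, ∀ y ∈ Γ, Green x y
  b2 : ran (Gamma0 Γ) = ⊤
  b3 : IsSelfAdj (ker (Gamma0 Γ))

/-- The Weyl family: `M(z) = {ĥ : {{f, z f}, ĥ} ∈ Γ for some f}`, a linear relation in `K`. -/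
def weyl (Γ : BRel H K) (z : ℂ) : Rel K where
  carrier := {p | ∃ f : H, ((f, z • f), p) ∈ Γ}
  add_mem' := by
    rintro p q ⟨f, hf⟩ ⟨g, hg⟩
    exact ⟨f + g, by simpa using Γ.add_mem hf hg⟩
  zero_mem' := ⟨0, by rw [smul_zero]; exact Γ.zero_mem⟩
  smul_mem' := by
    rintro c p ⟨f, hf⟩
    exact ⟨c • f, by simpa [smul_comm c z f] using Γ.smul_mem c hf⟩

/-- The γ-field: `γ(z) = {{h, f} : {{f, z f}, {h, h'}} ∈ Γ for some h'}`, a linear relation from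
`K` to `H`. -/
def gammaField (Γ : BRel H K) (z : ℂ) : Submodule ℂ (K × H) where
  carrier := {p | ∃ h' : K, ((p.2, z • p.2), (p.1, h')) ∈ Γ}
  add_mem' := by
    rintro p q ⟨h, hf⟩ ⟨k, hg⟩
    exact ⟨h + k, by simpa using Γ.add_mem hf hg⟩
  zero_mem' := ⟨0, by
    rw [Prod.fst_zero, Prod.snd_zero, smul_zero]; exact Γ.zero_mem⟩
  smul_mem' := by
    rintro c p ⟨h, hf⟩
    exact ⟨c • h, by simpa [smul_comm c z p.2] using Γ.smul_mem c hf⟩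

end Boundary

/-! ### Block decompositions

The orthogonal sum of `K₁` and `K₂` is `WithLp 2 (K₁ × K₂)`. -/

section Blocks

variable (K₁ : Type v) (K₂ : Type w)
variable [NormedAddCommGroup K₁] [InnerProductSpace ℂ K₁]
variable [NormedAddCommGroup K₂] [InnerProductSpace ℂ K₂]

/-- The embedding `a ↦ (a, 0)`. -/
def in1 : K₁ →L[ℂ] WithLp 2 (K₁ × K₂) :=
  (WithLp.prodContinuousLinearEquiv 2 ℂ K₁ K₂).symm.toContinuousLinearMap ∘L
    ContinuousLinearMap.inl ℂ K₁ K₂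

/-- The embedding `b ↦ (0, b)`. -/
def in2 : K₂ →L[ℂ] WithLp 2 (K₁ × K₂) :=
  (WithLp.prodContinuousLinearEquiv 2 ℂ K₁ K₂).symm.toContinuousLinearMap ∘L
    ContinuousLinearMap.inr ℂ K₁ K₂

variable {K₁ K₂}

/-- The blocks `M_{ij}` of a bounded operator `M` on the orthogonal sum. -/
def block11 (M : WithLp 2 (K₁ × K₂) →L[ℂ] WithLp 2 (K₁ × K₂)) : K₁ →L[ℂ] K₁ :=
  WithLp.fstL 2 ℂ K₁ K₂ ∘L M ∘L in1 K₁ K₂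

/-- The block from `K₂` to `K₁`. -/
def block12 (M : WithLp 2 (K₁ × K₂) →L[ℂ] WithLp 2 (K₁ × K₂)) : K₂ →L[ℂ] K₁ :=
  WithLp.fstL 2 ℂ K₁ K₂ ∘L M ∘L in2 K₁ K₂

/-- The block from `K₁` to `K₂`. -/
def block21 (M : WithLp 2 (K₁ × K₂) →L[ℂ] WithLp 2 (K₁ × K₂)) : K₁ →L[ℂ] K₂ :=
  WithLp.sndL 2 ℂ K₁ K₂ ∘L M ∘L in1 K₁ K₂

/-- The block from `K₂` to `K₂`. -/
def block22 (M : WithLp 2 (K₁ × K₂) →L[ℂ] WithLp 2 (K₁ × K₂)) : K₂ →L[ℂ] K₂ :=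
  WithLp.sndL 2 ℂ K₁ K₂ ∘L M ∘L in2 K₁ K₂

end Blocks

/-! ### The transformed relations -/

section Transform

variable {H : Type u} {K₁ : Type v} {K₂ : Type w}
variable [NormedAddCommGroup H] [InnerProductSpace ℂ H]
variable [NormedAddCommGroup K₁] [InnerProductSpace ℂ K₁] [CompleteSpace K₁]
variable [NormedAddCommGroup K₂] [InnerProductSpace ℂ K₂] [CompleteSpace K₂]

/-- `H_T = {f̂ ∈ S* : {f̂, {h, h'}} ∈ Γ, h = 0, h₂' = -T* h₁'}`. -/
def HT (S : Rel H)
    (Γ : BRel H (WithLp 2 (K₁ × K₂)))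
    (T : K₂ →L[ℂ] K₁) : Rel H where
  carrier := {f | f ∈ S.adjoint ∧ ∃ h h' : WithLp 2 (K₁ × K₂),
    (f, (h, h')) ∈ Γ ∧ h = 0 ∧ h'.snd = -ContinuousLinearMap.adjoint T h'.fst}
  add_mem' := by
    rintro f g ⟨hfS, h, h', hf, h0, h1⟩ ⟨hgS, k, k', hg, k0, k1⟩
    refine ⟨S.adjoint.add_mem hfS hgS, h + k, h' + k', by simpa using Γ.add_mem hf hg, ?_, ?_⟩
    · rw [h0, k0, add_zero]
    · rw [WithLp.add_snd, WithLp.add_fst, h1, k1, map_add, neg_add]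
  zero_mem' := ⟨S.adjoint.zero_mem, 0, 0, Γ.zero_mem, rfl, by simp⟩
  smul_mem' := by
    rintro c f ⟨hfS, h, h', hf, h0, h1⟩
    refine ⟨S.adjoint.smul_mem c hfS, c • h, c • h', by simpa using Γ.smul_mem c hf, ?_, ?_⟩
    · rw [h0, smul_zero]
    · rw [WithLp.smul_snd, WithLp.smul_fst, h1, map_smul, smul_neg]

/-- `Γ_T = {{f̂, {h₂, T* h₁' + h₂'}} : {f̂, {h, h'}} ∈ Γ, h₁ = T h₂}`. -/
def GammaT (Γ : BRel H (WithLp 2 (K₁ × K₂)))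
    (T : K₂ →L[ℂ] K₁) : BRel H K₂ where
  carrier := {x | ∃ h h' : WithLp 2 (K₁ × K₂), (x.1, (h, h')) ∈ Γ ∧ h.fst = T h.snd ∧
    x.2 = (h.snd, ContinuousLinearMap.adjoint T h'.fst + h'.snd)}
  add_mem' := by
    rintro x y ⟨h, h', hx, h0, h1⟩ ⟨k, k', hy, k0, k1⟩
    refine ⟨h + k, h' + k', by simpa using Γ.add_mem hx hy, ?_, ?_⟩
    · rw [WithLp.add_fst, WithLp.add_snd, h0, k0, map_add]
    · rw [Prod.snd_add, h1, k1, WithLp.add_snd, WithLp.add_fst, WithLp.add_snd, map_add,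
        Prod.mk_add_mk, add_add_add_comm]
  zero_mem' := ⟨0, 0, Γ.zero_mem, by simp, by
    rw [Prod.snd_zero, WithLp.zero_snd, WithLp.zero_fst, map_zero, add_zero, Prod.zero_eq_mk]⟩
  smul_mem' := by
    rintro c x ⟨h, h', hx, h0, h1⟩
    refine ⟨c • h, c • h', by simpa using Γ.smul_mem c hx, ?_, ?_⟩
    · rw [WithLp.smul_fst, WithLp.smul_snd, h0, map_smul]
    · rw [Prod.smul_snd, h1, WithLp.smul_snd, WithLp.smul_fst, WithLp.smul_snd, map_smul,
        Prod.smul_mk, smul_add]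

end Transform

/-! ### The coupling of two boundary relations -/

section Coupling

variable {H₁ : Type u} {H₂ : Type v} {K : Type w}
variable [NormedAddCommGroup H₁] [InnerProductSpace ℂ H₁]
variable [NormedAddCommGroup H₂] [InnerProductSpace ℂ H₂]
variable [NormedAddCommGroup K] [InnerProductSpace ℂ K]

/-- The first component `{f₁, f₁'}` of `{f₁ ⊕ f₂, f₁' ⊕ f₂'}`. -/
def comp1 (f : WithLp 2 (H₁ × H₂) × WithLp 2 (H₁ × H₂)) : H₁ × H₁ := (f.1.fst, f.2.fst)

/-- The second component `{f₂, f₂'}` of `{f₁ ⊕ f₂, f₁' ⊕ f₂'}`. -/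
def comp2 (f : WithLp 2 (H₁ × H₂) × WithLp 2 (H₁ × H₂)) : H₂ × H₂ := (f.1.snd, f.2.snd)

/-- `{f̂₁ ⊕ f̂₂ : {f̂₁, {0, h₁}} ∈ Γ₁, {f̂₂, {0, -h₁}} ∈ Γ₂ for some h₁}`. -/
def couplingKer (Γ₁ : BRel H₁ K) (Γ₂ : BRel H₂ K) :
    Rel (WithLp 2 (H₁ × H₂)) where
  carrier := {f | ∃ h₁ : K, (comp1 f, ((0 : K), h₁)) ∈ Γ₁ ∧ (comp2 f, ((0 : K), -h₁)) ∈ Γ₂}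
  add_mem' := by
    rintro f g ⟨h, h1, h2⟩ ⟨k, k1, k2⟩
    refine ⟨h + k, by simpa [comp1] using Γ₁.add_mem h1 k1, ?_⟩
    rw [neg_add]
    simpa [comp2] using Γ₂.add_mem h2 k2
  zero_mem' := ⟨0, Γ₁.zero_mem, by rw [neg_zero]; exact Γ₂.zero_mem⟩
  smul_mem' := by
    rintro c f ⟨h, h1, h2⟩
    refine ⟨c • h, by simpa [comp1] using Γ₁.smul_mem c h1, ?_⟩
    rw [← smul_neg]
    simpa [comp2] using Γ₂.smul_mem c h2

/-- `{{f̂₁ ⊕ f̂₂, {h, h₁ + h₂}} : {f̂₁, {h, h₁}} ∈ Γ₁, {f̂₂, {h, h₂}} ∈ Γ₂}`. -/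
def coupling (Γ₁ : BRel H₁ K) (Γ₂ : BRel H₂ K) :
    BRel (WithLp 2 (H₁ × H₂)) K where
  carrier := {x | ∃ h h₁ h₂ : K, (comp1 x.1, (h, h₁)) ∈ Γ₁ ∧ (comp2 x.1, (h, h₂)) ∈ Γ₂ ∧
    x.2 = (h, h₁ + h₂)}
  add_mem' := by
    rintro x y ⟨h, h1, h2, a, b, e⟩ ⟨k, k1, k2, a', b', e'⟩
    refine ⟨h + k, h1 + k1, h2 + k2, by simpa [comp1] using Γ₁.add_mem a a',
      by simpa [comp2] using Γ₂.add_mem b b', ?_⟩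
    rw [Prod.snd_add, e, e', Prod.mk_add_mk, add_add_add_comm]
  zero_mem' := ⟨0, 0, 0, Γ₁.zero_mem, Γ₂.zero_mem, by
    rw [Prod.snd_zero, add_zero, Prod.zero_eq_mk]⟩
  smul_mem' := by
    rintro c x ⟨h, h1, h2, a, b, e⟩
    refine ⟨c • h, c • h1, c • h2, by simpa [comp1] using Γ₁.smul_mem c a,
      by simpa [comp2] using Γ₂.smul_mem c b, ?_⟩
    rw [Prod.smul_snd, e, Prod.smul_mk, smul_add]

end Coupling

end BdryRel

end

noncomputable section

namespace BdryRel

universe u v w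

/-! ### Hilbert dimension and bounded isomorphisms -/

section HilbertDim

variable {E F : Type u}
variable [NormedAddCommGroup E] [InnerProductSpace ℂ E]
variable [NormedAddCommGroup F] [InnerProductSpace ℂ F]

/-! Everything follows from (B1)–(B3). Write A for the selfadjoint relation `ker (Gamma0 Γ)`. These
conditions force `Γ` to be maximal for Green's identity (`CondB.maximal`): by (B2), subtracting an
element of `Γ` removes the component h, selfadjointness of A handles the rest up to a vector in the
h' slot, and that vector is orthogonal to the range of `Gamma0 Γ`, hence zero. Maximality gives that
`ker Γ` is the adjoint of `dom Γ`, so `Γ` is a boundary relation for `(ker Γ).adjoint`. Since A lies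
between `ker Γ` and its adjoint, its resolvent carries the eigenspaces of that adjoint at nonreal
points isomorphically onto each other, and the defect numbers agree.

It remains to identify `HT` and `couplingKer` as kernels of `GammaT` and `coupling`, and to check
(B1)–(B3) for the latter. The transform leaves A unchanged; the coupling replaces it by an
orthogonal sum. The Weyl functions are read off from `CondB.exists_operators`. -/

/-- The isometric factor of the polar decomposition of a bounded isomorphism. -/
theorem exists_linearIsometryEquiv_of_continuousLinearEquiv [CompleteSpace E] [CompleteSpace F]
    (T : E ≃L[ℂ] F) : Nonempty (E ≃ₗᵢ[ℂ] F) := by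
  let A : E →L[ℂ] F := T
  let B : F →L[ℂ] E := T.symm
  let P : E →L[ℂ] E := ContinuousLinearMap.adjoint A ∘L A
  have hP : 0 ≤ P := by
    rw [ContinuousLinearMap.nonneg_iff_isPositive]
    exact ContinuousLinearMap.isPositive_adjoint_comp_self A
  have hAB : A ∘L B = ContinuousLinearMap.id ℂ F := by ext x; simp [A, B]
  have hBA : B ∘L A = ContinuousLinearMap.id ℂ E := by ext x; simp [A, B]
  have hBA' : ContinuousLinearMap.adjoint A ∘L ContinuousLinearMap.adjoint B =
      ContinuousLinearMap.id ℂ E := by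
    rw [← ContinuousLinearMap.adjoint_comp, hBA, ContinuousLinearMap.adjoint_id]
  have hAB' : ContinuousLinearMap.adjoint B ∘L ContinuousLinearMap.adjoint A =
      ContinuousLinearMap.id ℂ F := by
    rw [← ContinuousLinearMap.adjoint_comp, hAB, ContinuousLinearMap.adjoint_id]
  have hPu : IsUnit P := by
    -- With B the inverse of A, the inverse of A*A is BB*.
    refine ⟨⟨P, B ∘L ContinuousLinearMap.adjoint B, ?_, ?_⟩, rfl⟩
    · ext x
      have h1 := fun y => DFunLike.congr_fun hAB y
      have h2 := fun y => DFunLike.congr_fun hBA' y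
      simp only [ContinuousLinearMap.comp_apply, ContinuousLinearMap.id_apply] at h1 h2
      simp [P, h1, h2]
    · ext x
      have h1 := fun y => DFunLike.congr_fun hBA y
      have h2 := fun y => DFunLike.congr_fun hAB' y
      simp only [ContinuousLinearMap.comp_apply, ContinuousLinearMap.id_apply] at h1 h2
      simp [P, h1, h2]
  let Q : E →L[ℂ] E := CFC.sqrt P
  have hQ : 0 ≤ Q := CFC.sqrt_nonneg P
  have hQQ : Q * Q = P := CFC.sqrt_mul_sqrt_self P hP
  have hQu : IsUnit Q := (CFC.isUnit_sqrt_iff P hP).2 hPu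
  have hQs : ContinuousLinearMap.adjoint Q = Q := by
    rw [ContinuousLinearMap.nonneg_iff_isPositive] at hQ
    exact hQ.isSelfAdjoint.star_eq
  have hnorm : ∀ x, ‖A x‖ = ‖Q x‖ := by
    intro x
    have h : (inner ℂ (A x) (A x) : ℂ) = inner ℂ (Q x) (Q x) := by
      rw [← ContinuousLinearMap.adjoint_inner_right, ← ContinuousLinearMap.adjoint_inner_right Q,
        hQs]
      change inner ℂ x (P x) = inner ℂ x ((Q * Q) x)
      rw [hQQ]
    rw [inner_self_eq_norm_sq_to_K, inner_self_eq_norm_sq_to_K] at h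
    have h' : ‖A x‖ ^ 2 = ‖Q x‖ ^ 2 := by exact_mod_cast h
    exact (sq_eq_sq₀ (norm_nonneg _) (norm_nonneg _)).1 h'
  obtain ⟨q, hq⟩ := hQu
  let e : E ≃L[ℂ] E := ContinuousLinearEquiv.ofUnit q
  have he : ∀ x, e x = Q x := fun x => by rw [← hq]; rfl
  -- The unitary is A Q⁻¹, where Q is the square root of A*A.
  refine ⟨⟨(e.symm.trans T).toLinearEquiv, fun x => ?_⟩⟩
  change ‖A (e.symm x)‖ = ‖x‖
  rw [hnorm, ← he, e.apply_symm_apply]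

theorem hilbertDim_eq_of_continuousLinearEquiv [CompleteSpace E] [CompleteSpace F]
    (T : E ≃L[ℂ] F) : hilbertDim E = hilbertDim F := by
  obtain ⟨U⟩ := exists_linearIsometryEquiv_of_continuousLinearEquiv T
  unfold hilbertDim
  congr 1
  ext c
  constructor
  · rintro ⟨ι, ⟨b⟩, h⟩
    exact ⟨ι, ⟨⟨U.symm.trans b.repr⟩⟩, h⟩
  · rintro ⟨ι, ⟨b⟩, h⟩
    exact ⟨ι, ⟨⟨U.trans b.repr⟩⟩, h⟩

end HilbertDim

/-! ### Adjoints of linear relations -/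

section Adjoint

variable {E : Type u} {F : Type v}
variable [NormedAddCommGroup E] [InnerProductSpace ℂ E]
variable [NormedAddCommGroup F] [InnerProductSpace ℂ F]

theorem isClosed_adjoint (R : Submodule ℂ (E × F)) : IsClosed (R.adjoint : Set (F × E)) := by
  have h : (R.adjoint : Set (F × E)) =
      ⋂ a : E, ⋂ b : F, ⋂ _ : (a, b) ∈ R,
        {x : F × E | inner ℂ b x.1 - inner ℂ a x.2 = (0 : ℂ)} := by
    ext x
    simp only [SetLike.mem_coe, Submodule.mem_adjoint_iff, Set.mem_iInter, Set.mem_ofPred_eq]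
  rw [h]
  refine isClosed_iInter fun a => isClosed_iInter fun b => isClosed_iInter fun _ => ?_
  exact isClosed_eq (by fun_prop) continuous_const

/-- The orthogonal complement of R in the Hilbert sum is R* rotated by (x, y) ↦ (y, -x), so the
double adjoint becomes a double orthogonal complement, which is the closure. -/
theorem adjoint_adjoint_le [CompleteSpace E] [CompleteSpace F] (R : Submodule ℂ (E × F)) :
    R.adjoint.adjoint ≤ R.topologicalClosure := by
  intro p hp
  rw [Submodule.mem_adjoint_iff] at hp
  let R' : Submodule ℂ (WithLp 2 (E × F)) :=
    R.map (WithLp.linearEquiv 2 ℂ (E × F)).symm.toLinearMap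
  have key : WithLp.toLp 2 p ∈ R'ᗮᗮ := by
    rw [Submodule.mem_orthogonal]
    intro q hq
    rw [Submodule.mem_orthogonal] at hq
    have hq' : (q.snd, -q.fst) ∈ R.adjoint := by
      rw [Submodule.mem_adjoint_iff]
      intro a b hab
      have := hq (WithLp.toLp 2 (a, b)) ⟨(a, b), hab, rfl⟩
      rw [WithLp.prod_inner_apply] at this
      simp only [inner_neg_right, sub_neg_eq_add]
      rw [add_comm]
      exact this
    have := hp _ _ hq'
    rw [inner_neg_left] at this
    rw [WithLp.prod_inner_apply]
    change inner ℂ q.fst p.1 + inner ℂ q.snd p.2 = 0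
    linear_combination -this
  rw [Submodule.orthogonal_orthogonal_eq_closure] at key
  -- The Hilbert sum and the product with the max norm have the same topology; the closure is
  -- carried back to the latter.
  have hc : Continuous (WithLp.ofLp : WithLp 2 (E × F) → E × F) :=
    WithLp.prod_continuous_ofLp 2 E F
  refine map_mem_closure (t := (R : Set (E × F))) hc key ?_
  rintro x ⟨y, hy, rfl⟩
  exact hy

end Adjoint

/-! ### Selfadjoint relations: resolvents and equality of defect numbers -/

section SelfAdjoint

variable {H : Type u} [NormedAddCommGroup H] [InnerProductSpace ℂ H]

theorem mem_eigenspace {X : Type u} [AddCommGroup X] [Module ℂ X] {R : Submodule ℂ (X × X)}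
    {z : ℂ} {f : X} : f ∈ eigenspace R z ↔ (f, z • f) ∈ R := Iff.rfl

theorem IsSymm.inner_eq {A : Rel H} (hA : IsSymm A) {f f' g g' : H} (hf : (f, f') ∈ A)
    (hg : (g, g') ∈ A) : (inner ℂ g' f : ℂ) = inner ℂ g f' :=
  sub_eq_zero.1 ((Submodule.mem_adjoint_iff _ _).1 (hA hf) _ _ hg)

/-- Symmetry makes (f', f) real, so the imaginary part of (f' - zf, f) is -Im z ‖f‖²; Cauchy–Schwarz
finishes. -/
theorem IsSymm.im_mul_norm_le {A : Rel H} (hA : IsSymm A) {z : ℂ} {f f' : H}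
    (hf : (f, f') ∈ A) : |z.im| * ‖f‖ ≤ ‖f' - z • f‖ := by
  have h0 : (inner ℂ f f' : ℂ).im = 0 := by
    have h := hA.inner_eq hf hf
    rw [← inner_conj_symm] at h
    have := congrArg Complex.im h
    rw [Complex.conj_im] at this
    linarith
  have h1 : (inner ℂ f (f' - z • f) : ℂ).im = -(z.im * ‖f‖ ^ 2) := by
    rw [inner_sub_right, inner_smul_right, inner_self_eq_norm_sq_to_K, Complex.sub_im, h0]
    have : (((‖f‖ : ℝ) : ℂ) ^ 2) = ((‖f‖ ^ 2 : ℝ) : ℂ) := by push_cast; rfl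
    change 0 - (z * ((‖f‖ : ℝ) : ℂ) ^ 2).im = _
    rw [this, Complex.im_mul_ofReal]
    ring
  have h2 : |z.im| * ‖f‖ ^ 2 ≤ ‖f‖ * ‖f' - z • f‖ := by
    calc |z.im| * ‖f‖ ^ 2 = |(inner ℂ f (f' - z • f) : ℂ).im| := by
          rw [h1, abs_neg, abs_mul, abs_of_nonneg (sq_nonneg ‖f‖)]
      _ ≤ ‖(inner ℂ f (f' - z • f) : ℂ)‖ := Complex.abs_im_le_norm _
      _ ≤ _ := norm_inner_le_norm _ _
  rcases (norm_nonneg f).eq_or_lt with h | h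
  · rw [← h, mul_zero]
    exact norm_nonneg _
  · nlinarith

theorem IsSymm.eq_zero_of_mem {A : Rel H} (hA : IsSymm A) {z : ℂ} (hz : z.im ≠ 0) {f : H}
    (hf : (f, z • f) ∈ A) : f = 0 := by
  have h := hA.im_mul_norm_le (z := z) hf
  rw [sub_self, norm_zero] at h
  have hz' := abs_pos.2 hz
  exact norm_eq_zero.1 (le_antisymm (by nlinarith [norm_nonneg f]) (norm_nonneg f))

theorem IsSelfAdj.isSymm {A : Rel H} (hA : IsSelfAdj A) : IsSymm A := hA.ge

theorem IsSelfAdj.isClosed {A : Rel H} (hA : IsSelfAdj A) : IsClosed (A : Set (H × H)) := by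
  have h := isClosed_adjoint A
  rwa [hA] at h

/-- The resolvent of a selfadjoint relation at a nonreal point. -/
theorem IsSelfAdj.exists_resolvent [CompleteSpace H] {A : Rel H} (hA : IsSelfAdj A) {z : ℂ}
    (hz : z.im ≠ 0) : ∃ R : H →L[ℂ] H, ∀ g, (R g, g + z • R g) ∈ A := by
  have hz' := abs_pos.2 hz
  have : CompleteSpace A := hA.isClosed.completeSpace_coe
  let D : H × H →L[ℂ] H := ContinuousLinearMap.snd ℂ H H - z • ContinuousLinearMap.fst ℂ H H
  let L : A →L[ℂ] H := D ∘L A.subtypeL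
  have hL : ∀ p : A, L p = p.1.2 - z • p.1.1 := fun p => rfl
  -- The map L is A - z on the graph. The constant dominates both bounds ‖f‖ ≤ ‖Lp‖ / |Im z| and
  -- ‖f'‖ ≤ ‖Lp‖ + |z| ‖f‖, as the max norm requires.
  have hbound : ∀ p : A, ‖p‖ ≤ ((1 + ‖z‖) / |z.im| + 1) * ‖L p‖ := by
    rintro ⟨⟨f, f'⟩, hf⟩
    have h1 : ‖f‖ ≤ ‖f' - z • f‖ / |z.im| := by
      rw [le_div_iff₀ hz', mul_comm]
      exact hA.isSymm.im_mul_norm_le hf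
    have h2 : ‖f'‖ ≤ ‖f' - z • f‖ + ‖z‖ * ‖f‖ := by
      rw [← norm_smul]
      simpa using norm_add_le (f' - z • f) (z • f)
    have h3 : ((1 + ‖z‖) / |z.im| + 1) * ‖f' - z • f‖ =
        (1 + ‖z‖) * (‖f' - z • f‖ / |z.im|) + ‖f' - z • f‖ := by ring
    have h4 : ‖z‖ * ‖f‖ ≤ ‖z‖ * (‖f' - z • f‖ / |z.im|) :=
      mul_le_mul_of_nonneg_left h1 (norm_nonneg z)
    have h5 := norm_nonneg f
    have h6 := norm_nonneg (f' - z • f)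
    have h7 := mul_nonneg (norm_nonneg z) h5
    change max ‖f‖ ‖f'‖ ≤ ((1 + ‖z‖) / |z.im| + 1) * ‖f' - z • f‖
    rw [h3]
    exact max_le (by linarith) (by linarith)
  have hC : 0 ≤ (1 + ‖z‖) / |z.im| + 1 := by positivity
  have hanti : AntilipschitzWith ((1 + ‖z‖) / |z.im| + 1).toNNReal L :=
    L.antilipschitz_of_bound fun p => by
      rw [Real.coe_toNNReal _ hC]
      exact hbound p
  have hclosed : IsClosed (Set.range L) := hanti.isClosed_range L.uniformContinuous
  have hker : L.ker = ⊥ := LinearMap.ker_eq_bot.2 hanti.injective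
  have hrange : L.range = ⊤ := by
    have hcl : L.range.topologicalClosure = L.range :=
      IsClosed.submodule_topologicalClosure_eq hclosed
    rw [← hcl, Submodule.topologicalClosure_eq_top_iff, Submodule.eq_bot_iff]
    intro v hv
    rw [Submodule.mem_orthogonal] at hv
    -- A vector v orthogonal to the range satisfies (v, z̄v) ∈ A* = A, and z̄ is nonreal.
    refine hA.isSymm.eq_zero_of_mem (z := (starRingEnd ℂ) z) (by simpa using hz) ?_
    rw [← hA, Submodule.mem_adjoint_iff]
    intro a b hab
    have := hv _ ⟨⟨(a, b), hab⟩, rfl⟩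
    rw [ContinuousLinearMap.coe_coe, hL, inner_sub_left, inner_smul_left] at this
    simpa [inner_smul_right] using this
  let e := ContinuousLinearEquiv.ofBijective L hker hrange
  refine ⟨ContinuousLinearMap.fst ℂ H H ∘L A.subtypeL ∘L e.symm.toContinuousLinearMap,
    fun g => ?_⟩
  have h1 : (e.symm g).1.2 - z • (e.symm g).1.1 = g := e.apply_symm_apply g
  have h2 : g + z • (e.symm g).1.1 = (e.symm g).1.2 := by
    nth_rewrite 1 [← h1]
    abel
  change ((e.symm g).1.1, g + z • (e.symm g).1.1) ∈ A
  rw [h2]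
  exact (e.symm g).2

theorem isClosed_eigenspace {R : Rel H} (hR : IsClosed (R : Set (H × H))) (z : ℂ) :
    IsClosed (eigenspace R z : Set H) :=
  hR.preimage (f := fun f : H => (f, z • f)) (by fun_prop)

/-- The eigenspaces at nonreal points of an extension of a selfadjoint relation are isomorphic. -/
theorem IsSelfAdj.nonempty_eigenspace_equiv [CompleteSpace H] {A B : Rel H} (hA : IsSelfAdj A)
    (hAB : A ≤ B) {z w : ℂ} (hz : z.im ≠ 0) (hw : w.im ≠ 0) :
    Nonempty (eigenspace B z ≃L[ℂ] eigenspace B w) := by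
  -- With R = (A - w)⁻¹, adding (w - z)(Rf, f + wRf) to (f, zf) yields an eigenelement at w.
  have transfer : ∀ {z w : ℂ} {R : H →L[ℂ] H}, (∀ g, (R g, g + w • R g) ∈ A) →
      ∀ f ∈ eigenspace B z, f + (w - z) • R f ∈ eigenspace B w := by
    intro z w R hR f hf
    rw [mem_eigenspace] at hf ⊢
    have h := B.add_mem hf (B.smul_mem (w - z) (hAB (hR f)))
    convert h using 1
    ext
    · rfl
    · simp only [Prod.mk_add_mk, Prod.smul_mk]
      module
  -- For g = f + (w - z)Rf the vector Rf - Qg is an eigenvector of A at z, hence zero. So the two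
  -- transfer maps are mutually inverse.
  have resolvent_identity : ∀ {z w : ℂ} {R Q : H →L[ℂ] H}, z.im ≠ 0 →
      (∀ g, (R g, g + w • R g) ∈ A) → (∀ g, (Q g, g + z • Q g) ∈ A) →
      ∀ f, (f + (w - z) • R f) + (z - w) • Q (f + (w - z) • R f) = f := by
    intro z w R Q hz hR hQ f
    have h := A.sub_mem (hR f) (hQ (f + (w - z) • R f))
    have h0 : R f - Q (f + (w - z) • R f) = 0 := by
      refine hA.isSymm.eq_zero_of_mem hz ?_
      convert h using 1
      ext
      · rfl
      · simp only [Prod.mk_sub_mk]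
        module
    rw [← sub_eq_zero.1 h0]
    module
  obtain ⟨Q, hQ⟩ := hA.exists_resolvent hz
  obtain ⟨R, hR⟩ := hA.exists_resolvent hw
  let V : H →L[ℂ] H := ContinuousLinearMap.id ℂ H + (w - z) • R
  let W : H →L[ℂ] H := ContinuousLinearMap.id ℂ H + (z - w) • Q
  refine ⟨ContinuousLinearEquiv.equivOfInverse
    ((V ∘L (eigenspace B z).subtypeL).codRestrict (eigenspace B w)
      fun f => transfer hR f f.2)
    ((W ∘L (eigenspace B w).subtypeL).codRestrict (eigenspace B z)
      fun f => transfer hQ f f.2) ?_ ?_⟩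
  · intro f
    exact Subtype.ext (resolvent_identity hz hR hQ f)
  · intro f
    exact Subtype.ext (resolvent_identity hw hQ hR f)

/-- A relation that has a selfadjoint extension has equal defect numbers. -/
theorem IsSelfAdj.hasEqualDefect [CompleteSpace H] {A S : Rel H} (hA : IsSelfAdj A)
    (hSA : A ≤ S.adjoint) : HasEqualDefect S := by
  intro z w hz hw
  obtain ⟨e⟩ := hA.nonempty_eigenspace_equiv hSA hz.ne' hw.ne
  have : CompleteSpace (eigenspace S.adjoint z) :=
    (isClosed_eigenspace (isClosed_adjoint S) z).completeSpace_coe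
  have : CompleteSpace (eigenspace S.adjoint w) :=
    (isClosed_eigenspace (isClosed_adjoint S) w).completeSpace_coe
  exact hilbertDim_eq_of_continuousLinearEquiv e

end SelfAdjoint

/-! ### Consequences of the conditions (B1)-(B3) -/

section CondB

variable {H : Type u} {K : Type v}
variable [NormedAddCommGroup H] [InnerProductSpace ℂ H]
variable [NormedAddCommGroup K] [InnerProductSpace ℂ K]

theorem mem_dom {X : Type u} {Y : Type v} [AddCommGroup X] [Module ℂ X] [AddCommGroup Y]
    [Module ℂ Y] {R : Submodule ℂ (X × Y)} {x : X} : x ∈ dom R ↔ ∃ y, (x, y) ∈ R := by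
  simp [dom]

theorem mem_ker {X : Type u} {Y : Type v} [AddCommGroup X] [Module ℂ X] [AddCommGroup Y]
    [Module ℂ Y] {R : Submodule ℂ (X × Y)} {x : X} : x ∈ ker R ↔ (x, (0 : Y)) ∈ R := Iff.rfl

theorem mem_ker_Gamma0 {Γ : BRel H K} {f : H × H} :
    f ∈ ker (Gamma0 Γ) ↔ ∃ h' : K, (f, ((0 : K), h')) ∈ Γ := by
  rw [mem_ker]
  constructor
  · rintro ⟨⟨g, h, h'⟩, hx, e⟩
    obtain ⟨rfl, rfl⟩ : g = f ∧ h = 0 := Prod.ext_iff.1 e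
    exact ⟨h', hx⟩
  · rintro ⟨h', hx⟩
    exact ⟨_, hx, rfl⟩

theorem ran_Gamma0_eq_top_iff {Γ : BRel H K} :
    ran (Gamma0 Γ) = ⊤ ↔ ∀ h : K, ∃ (f : H × H) (h' : K), (f, (h, h')) ∈ Γ := by
  rw [Submodule.eq_top_iff']
  refine forall_congr' fun h => ⟨?_, ?_⟩
  · rintro ⟨⟨f, k⟩, ⟨⟨g, l, h'⟩, hx, e⟩, rfl⟩
    obtain ⟨rfl, rfl⟩ : g = f ∧ l = k := Prod.ext_iff.1 e
    exact ⟨g, h', hx⟩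
  · rintro ⟨f, h', hx⟩
    exact ⟨(f, h), ⟨_, hx, rfl⟩, rfl⟩

theorem Green.sub {x y y' : (H × H) × (K × K)} (h : Green x y) (h' : Green x y') :
    Green x (y - y') := by
  unfold Green at *
  simp only [Prod.fst_sub, Prod.snd_sub, inner_sub_left]
  linear_combination h - h'

namespace CondB

variable {Γ : BRel H K}

theorem exists_mem (hΓ : CondB Γ) (h : K) : ∃ (f : H × H) (h' : K), (f, (h, h')) ∈ Γ :=
  ran_Gamma0_eq_top_iff.1 hΓ.b2 h

/-- A relation with (B1)-(B3) is maximal with respect to Green's identity. -/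
theorem maximal (hΓ : CondB Γ) (y : (H × H) × (K × K)) (hy : ∀ x ∈ Γ, Green x y) : y ∈ Γ := by
  obtain ⟨g, k, k'⟩ := y
  obtain ⟨f, h', hf⟩ := hΓ.exists_mem k
  have h1 : ∀ x ∈ Γ, Green x ((g, (k, k')) - (f, (k, h'))) :=
    fun x hx => (hy x hx).sub (hΓ.b1 x hx _ hf)
  have h2 : g - f ∈ ker (Gamma0 Γ) := by
    rw [← hΓ.b3, Submodule.mem_adjoint_iff]
    intro a b hab
    obtain ⟨l, hl⟩ := mem_ker_Gamma0.1 hab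
    have h := h1 _ hl
    unfold Green at h
    simp only [Prod.fst_sub, Prod.snd_sub, sub_self, inner_zero_left, inner_zero_right] at h
    rw [← inner_conj_symm, ← inner_conj_symm a, ← map_sub, Prod.fst_sub, Prod.snd_sub, h, map_zero]
  obtain ⟨l, hl⟩ := mem_ker_Gamma0.1 h2
  -- What remains is {0, {0, m}} with m = k' - h' - l. Pairing it with an element of `Γ` whose
  -- component h equals m gives ‖m‖² = 0.
  have h3 : k' - h' - l = 0 := by
    obtain ⟨p, m, hp⟩ := hΓ.exists_mem (k' - h' - l)
    have h := (h1 _ hp).sub (hΓ.b1 _ hp _ hl)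
    unfold Green at h
    simp only [Prod.fst_sub, Prod.snd_sub, sub_self, Prod.fst_zero, Prod.snd_zero,
      inner_zero_left, zero_sub] at h
    exact (inner_self_eq_zero (𝕜 := ℂ)).1 (neg_eq_zero.1 h.symm)
  have h4 := Γ.add_mem hf hl
  convert h4 using 1
  ext <;> simp
  rw [← sub_eq_zero, ← h3]
  abel

theorem isClosed (hΓ : CondB Γ) : IsClosed (Γ : Set ((H × H) × (K × K))) := by
  have h : (Γ : Set ((H × H) × (K × K))) = ⋂ x ∈ Γ, {y | Green x y} := by
    ext y
    simp only [SetLike.mem_coe, Set.mem_iInter, Set.mem_ofPred_eq]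
    exact ⟨fun hy x hx => hΓ.b1 x hx y hy, hΓ.maximal y⟩
  rw [h]
  refine isClosed_biInter fun x _ => ?_
  unfold Green
  exact isClosed_eq (by fun_prop) (by fun_prop)

/-- Against an element {ĝ, 0} the boundary terms in Green's identity vanish, leaving the condition
that defines the adjoint; maximality gives the converse. -/
theorem ker_eq_adjoint_dom (hΓ : CondB Γ) : ker Γ = (dom Γ).adjoint := by
  ext g
  rw [mem_ker, Submodule.mem_adjoint_iff]
  constructor
  · intro hg a b hab
    obtain ⟨p, hp⟩ := mem_dom.1 hab
    have h := hΓ.b1 _ hp _ hg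
    unfold Green at h
    simp only [Prod.fst_zero, Prod.snd_zero, inner_zero_left, sub_self] at h
    rw [← inner_conj_symm, ← inner_conj_symm a, ← map_sub, h, map_zero]
  · intro hg
    refine hΓ.maximal _ fun x hx => ?_
    have h := hg x.1.1 x.1.2 (mem_dom.2 ⟨x.2, hx⟩)
    unfold Green
    simp only [Prod.fst_zero, Prod.snd_zero, inner_zero_left, sub_self]
    rw [← inner_conj_symm, ← inner_conj_symm g.2, ← map_sub, h, map_zero]

theorem ker_le_ker_Gamma0 : ker Γ ≤ ker (Gamma0 Γ) := fun _ hf => mem_ker_Gamma0.2 ⟨0, hf⟩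

theorem ker_Gamma0_le_adjoint_ker (hΓ : CondB Γ) : ker (Gamma0 Γ) ≤ (ker Γ).adjoint := by
  intro f hf
  rw [← hΓ.b3, Submodule.mem_adjoint_iff] at hf
  rw [Submodule.mem_adjoint_iff]
  exact fun a b hab => hf a b (ker_le_ker_Gamma0 hab)

theorem isClosedSymm_ker (hΓ : CondB Γ) : IsClosedSymm (ker Γ) := by
  refine ⟨?_, ker_le_ker_Gamma0.trans hΓ.ker_Gamma0_le_adjoint_ker⟩
  rw [hΓ.ker_eq_adjoint_dom]
  exact isClosed_adjoint _

variable [CompleteSpace H]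

theorem hasEqualDefect_ker (hΓ : CondB Γ) : HasEqualDefect (ker Γ) :=
  IsSelfAdj.hasEqualDefect hΓ.b3 hΓ.ker_Gamma0_le_adjoint_ker

/-- A relation with (B1)-(B3) is a boundary relation for the adjoint of its kernel. -/
theorem isBoundaryRelation (hΓ : CondB Γ) : IsBoundaryRelation (ker Γ) Γ where
  dom_le := by
    intro f hf
    obtain ⟨p, hp⟩ := mem_dom.1 hf
    rw [Submodule.mem_adjoint_iff]
    intro a b hab
    have h := hΓ.b1 _ hp _ (mem_ker.1 hab)
    unfold Green at h
    simp only [Prod.fst_zero, Prod.snd_zero, inner_zero_left, sub_self] at h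
    linear_combination -h
  dom_dense := by
    rw [hΓ.ker_eq_adjoint_dom]
    exact adjoint_adjoint_le _
  green := hΓ.b1
  maximal := hΓ.maximal

variable [CompleteSpace K]

/-- The γ-field and the Weyl family of a relation with (B1)-(B3) are bounded everywhere defined
operators. -/
theorem exists_operators (hΓ : CondB Γ) {z : ℂ} (hz : z.im ≠ 0) :
    ∃ (γ : K →L[ℂ] H) (M : K →L[ℂ] K),
      ∀ f h h', ((f, z • f), (h, h')) ∈ Γ ↔ f = γ h ∧ h' = M h := by
  obtain ⟨R, hR⟩ := IsSelfAdj.exists_resolvent hΓ.b3 hz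
  -- Subtracting the element of A at R(f' - zf) turns any element of `Γ` into an eigenelement at z
  -- without changing h.
  have hex : ∀ h : K, ∃ p : H × K, ((p.1, z • p.1), (h, p.2)) ∈ Γ := by
    intro h
    obtain ⟨f, h', hf⟩ := hΓ.exists_mem h
    obtain ⟨k', hk⟩ := mem_ker_Gamma0.1 (hR (f.2 - z • f.1))
    refine ⟨(f.1 - R (f.2 - z • f.1), h' - k'), ?_⟩
    have := Γ.sub_mem hf hk
    convert this using 1
    ext
    · rfl
    · simp only [Prod.fst_sub, Prod.snd_sub]
      module
    · simp
    · rfl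
  have huniq0 : ∀ (f : H) (k : K), ((f, z • f), ((0 : K), k)) ∈ Γ → f = 0 ∧ k = 0 := by
    intro f k hk
    obtain rfl : f = 0 := IsSelfAdj.isSymm hΓ.b3 |>.eq_zero_of_mem hz (mem_ker_Gamma0.2 ⟨k, hk⟩)
    refine ⟨rfl, ?_⟩
    obtain ⟨p, m, hp⟩ := hΓ.exists_mem k
    have h := hΓ.b1 _ hp _ hk
    unfold Green at h
    simp only [smul_zero, inner_zero_left, sub_self, zero_sub] at h
    exact (inner_self_eq_zero (𝕜 := ℂ)).1 (neg_eq_zero.1 h.symm)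
  have huniq : ∀ (h : K) (p q : H × K), ((p.1, z • p.1), (h, p.2)) ∈ Γ →
      ((q.1, z • q.1), (h, q.2)) ∈ Γ → p = q := by
    intro h p q hp hq
    have := Γ.sub_mem hp hq
    obtain ⟨h1, h2⟩ := huniq0 (p.1 - q.1) (p.2 - q.2) (by
      convert this using 1
      ext <;> simp [smul_sub])
    exact Prod.ext (sub_eq_zero.1 h1) (sub_eq_zero.1 h2)
  choose g hg using hex
  let G : K →ₗ[ℂ] H × K :=
    { toFun := g
      map_add' := fun a b => huniq _ _ _ (hg (a + b)) (by
        convert Γ.add_mem (hg a) (hg b) using 1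
        ext <;> simp)
      map_smul' := fun c a => huniq _ _ _ (hg (c • a)) (by
        convert Γ.smul_mem c (hg a) using 1
        ext <;> simp [smul_comm z c]) }
  -- The closed graph theorem, applied to h ↦ (f, h'), bounds the γ-field and the Weyl operator
  -- together.
  have hG : Continuous G := by
    refine G.continuous_of_isClosed_graph ?_
    have h : (G.graph : Set (K × (H × K))) =
        (fun x : K × (H × K) => ((x.2.1, z • x.2.1), (x.1, x.2.2))) ⁻¹'
          (Γ : Set ((H × H) × (K × K))) := by
      ext ⟨a, p⟩
      simp only [SetLike.mem_coe, LinearMap.mem_graph_iff, Set.mem_preimage]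
      constructor
      · rintro rfl
        exact hg a
      · intro h
        exact huniq a _ _ h (hg a)
    rw [h]
    exact hΓ.isClosed.preimage (by fun_prop)
  let G' : K →L[ℂ] H × K := ⟨G, hG⟩
  refine ⟨ContinuousLinearMap.fst ℂ H K ∘L G', ContinuousLinearMap.snd ℂ H K ∘L G', ?_⟩
  intro f h h'
  constructor
  · intro hf
    exact Prod.ext_iff.1 (huniq h (f, h') (g h) hf (hg h))
  · rintro ⟨rfl, rfl⟩
    exact hg h

end CondB

theorem gammaField_eq_graph {Γ : BRel H K} {z : ℂ} {γ : K →L[ℂ] H} {M : K →L[ℂ] K}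
    (h : ∀ f h h', ((f, z • f), (h, h')) ∈ Γ ↔ f = γ h ∧ h' = M h) :
    gammaField Γ z = γ.toLinearMap.graph := by
  ext ⟨a, f⟩
  rw [LinearMap.mem_graph_iff]
  change (∃ h' : K, ((f, z • f), (a, h')) ∈ Γ) ↔ f = γ a
  simp only [h, exists_and_left, exists_eq, and_true]

theorem weyl_eq_graph {Γ : BRel H K} {z : ℂ} {γ : K →L[ℂ] H} {M : K →L[ℂ] K}
    (h : ∀ f h h', ((f, z • f), (h, h')) ∈ Γ ↔ f = γ h ∧ h' = M h) :
    weyl Γ z = M.toLinearMap.graph := by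
  ext ⟨a, b⟩
  rw [LinearMap.mem_graph_iff]
  change (∃ f : H, ((f, z • f), (a, b)) ∈ Γ) ↔ b = M a
  simp only [h, exists_eq_left]

end CondB

section Blocks

variable {K₁ : Type v} {K₂ : Type w}
variable [NormedAddCommGroup K₁] [InnerProductSpace ℂ K₁]
variable [NormedAddCommGroup K₂] [InnerProductSpace ℂ K₂]

theorem in1_add_in2 (a : K₁) (b : K₂) :
    in1 K₁ K₂ a + in2 K₁ K₂ b = WithLp.toLp 2 (a, b) := by
  change WithLp.toLp 2 (a, (0 : K₂)) + WithLp.toLp 2 ((0 : K₁), b) = _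
  rw [← WithLp.toLp_add, Prod.mk_add_mk, add_zero, zero_add]

end Blocks

/-! ### The transform by an operator -/

section Transform

variable {H : Type u} {K₁ : Type v} {K₂ : Type w}
variable [NormedAddCommGroup H] [InnerProductSpace ℂ H]
variable [NormedAddCommGroup K₁] [InnerProductSpace ℂ K₁] [CompleteSpace K₁]
variable [NormedAddCommGroup K₂] [InnerProductSpace ℂ K₂] [CompleteSpace K₂]
variable {Γ : BRel H (WithLp 2 (K₁ × K₂))} {T : K₂ →L[ℂ] K₁}

theorem mem_GammaT {f : H × H} {k k' : K₂} :
    (f, (k, k')) ∈ GammaT Γ T ↔ ∃ h' : WithLp 2 (K₁ × K₂),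
      (f, (WithLp.toLp 2 (T k, k), h')) ∈ Γ ∧
        k' = ContinuousLinearMap.adjoint T h'.fst + h'.snd := by
  constructor
  · rintro ⟨h, h', hf, h1, e⟩
    obtain ⟨rfl, rfl⟩ := Prod.ext_iff.1 e
    refine ⟨h', ?_, rfl⟩
    have : WithLp.toLp 2 (T h.snd, h.snd) = h := by
      rw [← h1]
      rfl
    dsimp only
    rwa [this]
  · rintro ⟨h', hf, rfl⟩
    exact ⟨_, h', hf, rfl, rfl⟩

/-- On `GammaT` one has h = (Tk, k), which vanishes exactly when k does. Condition (B3) is thus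
inherited. -/
theorem ker_Gamma0_GammaT : ker (Gamma0 (GammaT Γ T)) = ker (Gamma0 Γ) := by
  ext f
  have h0 : (WithLp.toLp 2 (T 0, (0 : K₂)) : WithLp 2 (K₁ × K₂)) = 0 := by
    rw [map_zero]
    rfl
  simp only [mem_ker_Gamma0, mem_GammaT, h0]
  exact ⟨fun ⟨_, h', hf, _⟩ => ⟨h', hf⟩, fun ⟨h', hf⟩ => ⟨_, h', hf, rfl⟩⟩

theorem CondB.gammaT (hΓ : CondB Γ) : CondB (GammaT Γ T) where
  b1 := by
    rintro ⟨f, k, k'⟩ hx ⟨g, l, l'⟩ hy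
    obtain ⟨a, ha, rfl⟩ := mem_GammaT.1 hx
    obtain ⟨b, hb, rfl⟩ := mem_GammaT.1 hy
    have h := hΓ.b1 _ ha _ hb
    unfold Green at h ⊢
    refine h.trans ?_
    -- Moving T across the inner product: (h₁', Tk) + (h₂', k) = (T*h₁' + h₂', k).
    simp only [WithLp.prod_inner_apply, inner_add_left, inner_add_right,
      ContinuousLinearMap.adjoint_inner_left, ContinuousLinearMap.adjoint_inner_right]
    rfl
  b2 := by
    rw [ran_Gamma0_eq_top_iff]
    intro k
    obtain ⟨f, h', hf⟩ := hΓ.exists_mem (WithLp.toLp 2 (T k, k))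
    exact ⟨f, _, mem_GammaT.2 ⟨h', hf, rfl⟩⟩
  b3 := by
    rw [ker_Gamma0_GammaT]
    exact hΓ.b3

theorem HT_eq_ker {S : Rel H} (hS : dom Γ ≤ S.adjoint) : HT S Γ T = ker (GammaT Γ T) := by
  have h0 : (WithLp.toLp 2 (T 0, (0 : K₂)) : WithLp 2 (K₁ × K₂)) = 0 := by
    rw [map_zero]
    rfl
  ext f
  rw [mem_ker, ← Prod.mk_zero_zero, mem_GammaT, h0]
  constructor
  · rintro ⟨-, h, h', hf, rfl, e⟩
    exact ⟨h', hf, by rw [e, add_neg_cancel]⟩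
  · rintro ⟨h', hf, e⟩
    exact ⟨hS (mem_dom.2 ⟨_, hf⟩), 0, h', hf, rfl, eq_neg_of_add_eq_zero_right e.symm⟩

theorem mem_dom_GammaT {S : Rel H} (hS : dom Γ ≤ S.adjoint) (f : H × H) :
    f ∈ dom (GammaT Γ T) ↔
      f ∈ S.adjoint ∧ ∃ h h' : WithLp 2 (K₁ × K₂), (f, (h, h')) ∈ Γ ∧ h.fst = T h.snd := by
  rw [mem_dom]
  constructor
  · rintro ⟨_, h, h', hf, e, -⟩
    exact ⟨hS (mem_dom.2 ⟨_, hf⟩), h, h', hf, e⟩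
  · rintro ⟨-, h, h', hf, e⟩
    exact ⟨_, h, h', hf, e, rfl⟩

/-- The column k ↦ (Tk, k) precedes γ and M, and its adjoint row (T*, I) follows M; expanding in
blocks gives the formulas. -/
theorem mem_GammaT_iff_of_operators {z : ℂ} {γ : WithLp 2 (K₁ × K₂) →L[ℂ] H}
    {M : WithLp 2 (K₁ × K₂) →L[ℂ] WithLp 2 (K₁ × K₂)}
    (h : ∀ f h h', ((f, z • f), (h, h')) ∈ Γ ↔ f = γ h ∧ h' = M h) (f : H) (k k' : K₂) :
    ((f, z • f), (k, k')) ∈ GammaT Γ T ↔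
      f = ((γ ∘L in1 K₁ K₂) ∘L T + γ ∘L in2 K₁ K₂) k ∧
      k' = (ContinuousLinearMap.adjoint T ∘L block11 M ∘L T +
        ContinuousLinearMap.adjoint T ∘L block12 M + block21 M ∘L T + block22 M) k := by
  have e1 : ((γ ∘L in1 K₁ K₂) ∘L T + γ ∘L in2 K₁ K₂) k = γ (WithLp.toLp 2 (T k, k)) := by
    rw [← in1_add_in2, map_add]
    rfl
  have e2 : (ContinuousLinearMap.adjoint T ∘L block11 M ∘L T +
        ContinuousLinearMap.adjoint T ∘L block12 M + block21 M ∘L T + block22 M) k =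
      ContinuousLinearMap.adjoint T (M (WithLp.toLp 2 (T k, k))).fst +
        (M (WithLp.toLp 2 (T k, k))).snd := by
    rw [← in1_add_in2, map_add, WithLp.add_fst, WithLp.add_snd, map_add, ← add_assoc]
    rfl
  rw [mem_GammaT, e1, e2]
  simp only [h]
  constructor
  · rintro ⟨h', ⟨h1, rfl⟩, h2⟩
    exact ⟨h1, h2⟩
  · rintro ⟨h1, h2⟩
    exact ⟨_, ⟨h1, rfl⟩, h2⟩

end Transform

/-! ### The coupling of two boundary relations -/

section Coupling

variable {H₁ : Type u} {H₂ : Type v} {K : Type w}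
variable [NormedAddCommGroup H₁] [InnerProductSpace ℂ H₁]
variable [NormedAddCommGroup H₂] [InnerProductSpace ℂ H₂]
variable [NormedAddCommGroup K] [InnerProductSpace ℂ K]
variable {Γ₁ : BRel H₁ K} {Γ₂ : BRel H₂ K}

theorem mem_coupling {f : WithLp 2 (H₁ × H₂) × WithLp 2 (H₁ × H₂)} {h h' : K} :
    (f, (h, h')) ∈ coupling Γ₁ Γ₂ ↔ ∃ h₁ h₂ : K, (comp1 f, (h, h₁)) ∈ Γ₁ ∧
      (comp2 f, (h, h₂)) ∈ Γ₂ ∧ h' = h₁ + h₂ := by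
  constructor
  · rintro ⟨k, h₁, h₂, a, b, e⟩
    obtain ⟨rfl, e'⟩ := Prod.ext_iff.1 e
    exact ⟨h₁, h₂, a, b, e'⟩
  · rintro ⟨h₁, h₂, a, b, rfl⟩
    exact ⟨h, h₁, h₂, a, b, rfl⟩

theorem couplingKer_eq_ker : couplingKer Γ₁ Γ₂ = ker (coupling Γ₁ Γ₂) := by
  ext f
  rw [mem_ker, ← Prod.mk_zero_zero, mem_coupling]
  constructor
  · rintro ⟨h, a, b⟩
    exact ⟨h, -h, a, b, (add_neg_cancel h).symm⟩
  · rintro ⟨h₁, h₂, a, b, e⟩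
    obtain rfl : h₂ = -h₁ := eq_neg_of_add_eq_zero_right e.symm
    exact ⟨h₁, a, b⟩

/-- Once h = 0 the two systems decouple, so the kernel is the orthogonal sum of two selfadjoint
relations. -/
theorem mem_ker_Gamma0_coupling {f : WithLp 2 (H₁ × H₂) × WithLp 2 (H₁ × H₂)} :
    f ∈ ker (Gamma0 (coupling Γ₁ Γ₂)) ↔
      comp1 f ∈ ker (Gamma0 Γ₁) ∧ comp2 f ∈ ker (Gamma0 Γ₂) := by
  simp only [mem_ker_Gamma0, mem_coupling]
  constructor
  · rintro ⟨_, h₁, h₂, a, b, -⟩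
    exact ⟨⟨h₁, a⟩, ⟨h₂, b⟩⟩
  · rintro ⟨⟨h₁, a⟩, ⟨h₂, b⟩⟩
    exact ⟨_, h₁, h₂, a, b, rfl⟩

theorem CondB.coupling (h₁ : CondB Γ₁) (h₂ : CondB Γ₂) : CondB (coupling Γ₁ Γ₂) := by
  have b1 : ∀ x ∈ BdryRel.coupling Γ₁ Γ₂, ∀ y ∈ BdryRel.coupling Γ₁ Γ₂, Green x y := by
    rintro ⟨f, h, h'⟩ hx ⟨g, k, k'⟩ hy
    obtain ⟨a₁, a₂, hf₁, hf₂, rfl⟩ := mem_coupling.1 hx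
    obtain ⟨b₁, b₂, hg₁, hg₂, rfl⟩ := mem_coupling.1 hy
    have e₁ := h₁.b1 _ hf₁ _ hg₁
    have e₂ := h₂.b1 _ hf₂ _ hg₂
    unfold Green at *
    simp only [comp1, comp2] at e₁ e₂
    simp only [WithLp.prod_inner_apply, WithLp.ofLp_fst, WithLp.ofLp_snd, inner_add_left,
      inner_add_right]
    -- Both systems share the component h, so their boundary terms add up to those of h₁ + h₂.
    linear_combination e₁ + e₂
  refine ⟨b1, ?_, le_antisymm ?_ ?_⟩
  · rw [ran_Gamma0_eq_top_iff]
    intro h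
    obtain ⟨f, a, hf⟩ := h₁.exists_mem h
    obtain ⟨g, b, hg⟩ := h₂.exists_mem h
    exact ⟨(WithLp.toLp 2 (f.1, g.1), WithLp.toLp 2 (f.2, g.2)), a + b,
      mem_coupling.2 ⟨a, b, hf, hg, rfl⟩⟩
  · intro f hf
    rw [Submodule.mem_adjoint_iff] at hf
    rw [mem_ker_Gamma0_coupling]
    constructor
    · rw [← h₁.b3, Submodule.mem_adjoint_iff]
      intro a b hab
      -- Testing with elements supported in one summand isolates that component.
      have h := hf (WithLp.toLp 2 (a, 0)) (WithLp.toLp 2 (b, 0))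
        (mem_ker_Gamma0_coupling.2 ⟨hab, zero_mem _⟩)
      simpa [WithLp.prod_inner_apply, comp1] using h
    · rw [← h₂.b3, Submodule.mem_adjoint_iff]
      intro a b hab
      have h := hf (WithLp.toLp 2 (0, a)) (WithLp.toLp 2 (0, b))
        (mem_ker_Gamma0_coupling.2 ⟨zero_mem _, hab⟩)
      simpa [WithLp.prod_inner_apply, comp2] using h
  · intro f hf
    obtain ⟨h', hf⟩ := mem_ker_Gamma0.1 hf
    rw [Submodule.mem_adjoint_iff]
    intro a b hab
    obtain ⟨k', hab⟩ := mem_ker_Gamma0.1 hab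
    have h := b1 _ hf _ hab
    unfold Green at h
    simp only [inner_zero_left, inner_zero_right, sub_self] at h
    linear_combination -h

/-- An eigenelement of the sum splits into eigenelements with the same h; the γ-field is the column
h ↦ γ₁h ⊕ γ₂h. -/
theorem mem_coupling_iff_of_operators {z : ℂ} {γ₁ : K →L[ℂ] H₁} {γ₂ : K →L[ℂ] H₂}
    {M₁ M₂ : K →L[ℂ] K}
    (h₁ : ∀ f h h', ((f, z • f), (h, h')) ∈ Γ₁ ↔ f = γ₁ h ∧ h' = M₁ h)
    (h₂ : ∀ f h h', ((f, z • f), (h, h')) ∈ Γ₂ ↔ f = γ₂ h ∧ h' = M₂ h)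
    (f : WithLp 2 (H₁ × H₂)) (h h' : K) :
    ((f, z • f), (h, h')) ∈ coupling Γ₁ Γ₂ ↔
      f = (in1 H₁ H₂ ∘L γ₁ + in2 H₁ H₂ ∘L γ₂) h ∧ h' = (M₁ + M₂) h := by
  have e : (in1 H₁ H₂ ∘L γ₁ + in2 H₁ H₂ ∘L γ₂) h = WithLp.toLp 2 (γ₁ h, γ₂ h) :=
    in1_add_in2 _ _
  rw [mem_coupling, e]
  constructor
  · rintro ⟨a, b, ha, hb, rfl⟩
    obtain ⟨hf₁, rfl⟩ := (h₁ f.fst h a).1 ha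
    obtain ⟨hf₂, rfl⟩ := (h₂ f.snd h b).1 hb
    refine ⟨?_, rfl⟩
    rw [← hf₁, ← hf₂]
    rfl
  · rintro ⟨rfl, rfl⟩
    exact ⟨_, _, (h₁ _ h _).2 ⟨rfl, rfl⟩, (h₂ _ h _).2 ⟨rfl, rfl⟩, rfl⟩

end Coupling

end BdryRel

end

open BdryRel in
theorem proposition5p4
    {H K₁ K₂ : Type*}
    [NormedAddCommGroup H] [InnerProductSpace ℂ H] [CompleteSpace H]
    [NormedAddCommGroup K₁] [InnerProductSpace ℂ K₁] [CompleteSpace K₁]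
    [NormedAddCommGroup K₂] [InnerProductSpace ℂ K₂] [CompleteSpace K₂]
    {H₁ H₂ K : Type*}
    [NormedAddCommGroup H₁] [InnerProductSpace ℂ H₁] [CompleteSpace H₁]
    [NormedAddCommGroup H₂] [InnerProductSpace ℂ H₂] [CompleteSpace H₂]
    [NormedAddCommGroup K] [InnerProductSpace ℂ K] [CompleteSpace K] :
    -- the transform by an operator `T`
    (∀ (S : Rel H)
      (Γ : BRel H (WithLp 2 (K₁ × K₂)))
      (T : K₂ →L[ℂ] K₁),
      IsClosedSymm S → IsBoundaryRelation S Γ → CondB Γ →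
        IsClosedSymm (HT S Γ T) ∧ HasEqualDefect (HT S Γ T) ∧
        IsBoundaryRelation (HT S Γ T) (GammaT Γ T) ∧ CondB (GammaT Γ T) ∧
        (∀ f : H × H, f ∈ dom (GammaT Γ T) ↔
          f ∈ S.adjoint ∧ ∃ h h' : WithLp 2 (K₁ × K₂), (f, (h, h')) ∈ Γ ∧ h.fst = T h.snd) ∧
        ∀ z : ℂ, z.im ≠ 0 →
          ∃ (γ : WithLp 2 (K₁ × K₂) →L[ℂ] H)
            (M : WithLp 2 (K₁ × K₂) →L[ℂ] WithLp 2 (K₁ × K₂)),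
            gammaField Γ z = γ.toLinearMap.graph ∧
            weyl Γ z = M.toLinearMap.graph ∧
            gammaField (GammaT Γ T) z =
              ((γ ∘L in1 K₁ K₂) ∘L T + γ ∘L in2 K₁ K₂).toLinearMap.graph ∧
            weyl (GammaT Γ T) z =
              (ContinuousLinearMap.adjoint T ∘L block11 M ∘L T +
                ContinuousLinearMap.adjoint T ∘L block12 M +
                block21 M ∘L T + block22 M).toLinearMap.graph) ∧
    -- the coupling of two boundary relations
    (∀ (S₁ : Rel H₁) (S₂ : Rel H₂)
      (Γ₁ : BRel H₁ K) (Γ₂ : BRel H₂ K),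
      IsClosedSymm S₁ → IsClosedSymm S₂ →
      IsBoundaryRelation S₁ Γ₁ → IsBoundaryRelation S₂ Γ₂ → CondB Γ₁ → CondB Γ₂ →
        IsClosedSymm (couplingKer Γ₁ Γ₂) ∧ HasEqualDefect (couplingKer Γ₁ Γ₂) ∧
        IsBoundaryRelation (couplingKer Γ₁ Γ₂) (coupling Γ₁ Γ₂) ∧ CondB (coupling Γ₁ Γ₂) ∧
        ∀ z : ℂ, z.im ≠ 0 →
          ∃ M₁ M₂ : K →L[ℂ] K,
            weyl Γ₁ z = M₁.toLinearMap.graph ∧ weyl Γ₂ z = M₂.toLinearMap.graph ∧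
            weyl (coupling Γ₁ Γ₂) z = (M₁ + M₂).toLinearMap.graph) := by
  refine ⟨fun S Γ T _ hS hΓ => ?_, fun S₁ S₂ Γ₁ Γ₂ _ _ _ _ h₁ h₂ => ?_⟩
  · have hT : CondB (GammaT Γ T) := hΓ.gammaT
    rw [HT_eq_ker hS.dom_le]
    refine ⟨hT.isClosedSymm_ker, hT.hasEqualDefect_ker, hT.isBoundaryRelation, hT,
      mem_dom_GammaT hS.dom_le, fun z hz => ?_⟩
    obtain ⟨γ, M, h⟩ := hΓ.exists_operators hz
    have h' := mem_GammaT_iff_of_operators (T := T) h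
    exact ⟨γ, M, gammaField_eq_graph h, weyl_eq_graph h, gammaField_eq_graph h',
      weyl_eq_graph h'⟩
  · have h₃ : CondB (coupling Γ₁ Γ₂) := h₁.coupling h₂
    rw [couplingKer_eq_ker]
    refine ⟨h₃.isClosedSymm_ker, h₃.hasEqualDefect_ker, h₃.isBoundaryRelation, h₃,
      fun z hz => ?_⟩
    obtain ⟨γ₁, M₁, e₁⟩ := h₁.exists_operators hz
    obtain ⟨γ₂, M₂, e₂⟩ := h₂.exists_operators hz
    exact ⟨M₁, M₂, weyl_eq_graph e₁, weyl_eq_graph e₂,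
      weyl_eq_graph (mem_coupling_iff_of_operators e₁ e₂)⟩
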